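/- Let $T=\{1243,1342,2413\}$, and for $n\ge 0$ let $S_n(T)$ be the set of permutations of $\{1,\dots,n\}$ (in one-line notation) that avoid every pattern in $T$, i.e. that have no subsequence order-isomorphic to an element of $T$. Let $F_T(x)=\sum_{n\ge 0}|S_n(T)|\,x^n$ be the generating function. Then $$F_T(x)=\frac{(1-2x)\bigl(1-2x-\sqrt{1-8x+20x^2-20x^3+4x^4}\,\bigr)}{2x\,(1-4x+5x^2-x^3)}$$ as formal power series, where the square root denotes the formal power series with constant term $1$ whose square is $1-8x+20x^2-20x^3+4x^4$. -/

import Mathlib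

open PowerSeries LaurentSeries

namespace PatternAvoidance

/-- The permutation `σ` of `{0, …, n-1}` (in one-line notation `σ 0, σ 1, …, σ (n-1)`) contains the
pattern `τ`: some subsequence of `σ`, taken at the increasing positions `f 0 < … < f (k-1)`, is
order-isomorphic to `τ`. -/
def Contains {n k : ℕ} (σ : Equiv.Perm (Fin n)) (τ : Equiv.Perm (Fin k)) : Prop :=
  ∃ f : Fin k ↪o Fin n, ∀ i j : Fin k, σ (f i) < σ (f j) ↔ τ i < τ j

/-- `S_n(T)`: the permutations of length `n` that contain no pattern of `T`. -/
def avoiders {k : ℕ} (T : Set (Equiv.Perm (Fin k))) (n : ℕ) : Set (Equiv.Perm (Fin n)) :=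
  {σ | ∀ τ ∈ T, ¬ Contains σ τ}

/-- The formal power series `F_T(x) = ∑_{n ≥ 0} |S_n(T)| x ^ n`. -/
noncomputable def genFun {k : ℕ} (T : Set (Equiv.Perm (Fin k))) : ℚ⟦X⟧ :=
  PowerSeries.mk fun n => ((avoiders T n).ncard : ℚ)

/-- The pattern `1243`, with letters shifted down by one. -/
def p1243 : Equiv.Perm (Fin 4) where
  toFun := ![0, 1, 3, 2]
  invFun := ![0, 1, 3, 2]
  left_inv := by decide
  right_inv := by decide

/-- The pattern `1342`, with letters shifted down by one. -/
def p1342 : Equiv.Perm (Fin 4) where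
  toFun := ![0, 2, 3, 1]
  invFun := ![0, 3, 1, 2]
  left_inv := by decide
  right_inv := by decide

/-- The pattern `2413`, with letters shifted down by one. -/
def p2413 : Equiv.Perm (Fin 4) where
  toFun := ![1, 3, 0, 2]
  invFun := ![2, 0, 3, 1]
  left_inv := by decide
  right_inv := by decide

end PatternAvoidance

/-!
Write a nonempty avoiding word on the letters `0, …, n` as `L n R`. Let `t - 1` be the greatest
letter of `R` (with `t = 0` if `R` is empty) and `q` the least letter of `L`, or `t` if that letter
is not below `t`. The letters of `L` from `t` on precede its other letters: if `a < b` stood in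
this order in `L` with `a < t - 1`, then `a b n (t-1)` would be a `1243` or a `1342`. The letters of
`R` below `q` follow its other letters, since `q n b c` with `b < q < c` would be a `2413`. So the
word is `A u n w D`, where `A` and `D` are arbitrary avoiding words on `[t, n)` and `[0, q)`, and
the core `(u, w)` on `[q, t)` is either empty or consists of a decreasing word `u` ending in `q` and
a word `w` that contains `t - 1`, decreases and then increases, and has no letter of `u` between
two letters of `w` that stand in increasing order. Hence `F = 1 + x F² H`, where `H` counts the
cores.

A nonempty core arises by adding letters in increasing order in front of `u`, in front of `w`, or
at the end of `w`, the last for nonempty `w` only as long as `w` lies above `u`. This gives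
`(1 - 2x)² H = 1 - 4x + 5x² - x³`, and completing the square yields
`(1 - 2xFH)² = 1 - 4xH`.
-/

namespace PatternAvoidance

open scoped List

section OrderedWords

variable {α : Type*}

/-- The word `l` has no subsequence order-isomorphic to `1243`, `1342` or `2413`. -/
def AvoidsPatterns [LT α] (l : List α) : Prop :=
  ∀ a b c d, [a, b, c, d] <+ l →
    ¬(a < b ∧ b < d ∧ d < c) ∧ ¬(a < d ∧ d < b ∧ b < c) ∧ ¬(c < a ∧ a < d ∧ d < b)

/-- A word in which no letter lies above letters on both of its sides. For distinct letters this
means that the word decreases to its least letter and increases from there on. -/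
def IsValley [LT α] (w : List α) : Prop :=
  ∀ a b c, [a, b, c] <+ w → ¬(a < b ∧ c < b)

/-- No letter of `u` lies strictly between the values of two letters of `w` that stand in
increasing order: the pattern `2413` does not occur with its `2` in `u`, a larger letter than all
of `w` as its `4`, and `13` in `w`. -/
def Unsplit [LT α] (u w : List α) : Prop :=
  ∀ a ∈ u, w.Pairwise fun b c => ¬(b < a ∧ a < c)

/-- Every letter of `u` is smaller than every letter of `w`. -/
def Below [LT α] (u w : List α) : Prop :=
  ∀ a ∈ u, ∀ b ∈ w, a < b

theorem AvoidsPatterns.sublist [LT α] {l m : List α} (h : AvoidsPatterns m) (hl : l <+ m) :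
    AvoidsPatterns l :=
  fun a b c d hs => h a b c d (hs.trans hl)

theorem IsValley.sublist [LT α] {l m : List α} (h : IsValley m) (hl : l <+ m) : IsValley l :=
  fun a b c hs => h a b c (hs.trans hl)

theorem Unsplit.sublist [LT α] {u u' w w' : List α} (h : Unsplit u' w') (hu : u <+ u')
    (hw : w <+ w') : Unsplit u w :=
  fun a ha => (h a (hu.subset ha)).sublist hw

theorem isValley_nil [LT α] : IsValley ([] : List α) :=
  fun _ _ _ h => absurd h.length_le (by simp)

theorem eq_filter_append_filter_not {p : α → Prop} [DecidablePred p] {l : List α}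
    (h : l.Pairwise fun a b => p b → p a) :
    l = l.filter p ++ l.filter fun x => ¬p x := by
  induction l with
  | nil => rfl
  | cons x l ih =>
    obtain ⟨hx, hl⟩ := List.pairwise_cons.1 h
    by_cases hpx : p x
    · simpa [hpx] using ih hl
    · have hpl : ∀ y ∈ l, ¬p y := fun y hy hpy => hpx (hx y hy hpy)
      have hp : l.filter p = [] := by simpa using hpl
      have hnp : (l.filter fun x => ¬p x) = l := by simpa using hpl
      simp only [List.filter_cons, hpx, hp, hnp, decide_false, decide_true, not_false_eq_true,
        if_true, Bool.false_eq_true, if_false, List.nil_append]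

section Preorder

variable [Preorder α]

theorem isValley_cons {t : α} {w : List α} (h : ∀ x ∈ w, x < t) :
    IsValley (t :: w) ↔ IsValley w := by
  refine ⟨fun h' => h'.sublist (List.sublist_cons_self t w), fun h' a b c hs => ?_⟩
  rcases List.sublist_cons_iff.1 hs with hs | ⟨r, hr, hs⟩
  · exact h' a b c hs
  · obtain ⟨rfl, rfl⟩ := List.cons.inj hr
    exact fun hab => lt_asymm hab.1 (h b (hs.subset (by simp)))

theorem isValley_reverse {w : List α} : IsValley w.reverse ↔ IsValley w := by
  have reverse_of : ∀ {w : List α}, IsValley w → IsValley w.reverse := fun h a b c hs hb =>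
    h c b a (by simpa using hs.reverse) hb.symm
  exact ⟨fun h => by simpa using reverse_of h, reverse_of⟩

theorem isValley_concat {t : α} {w : List α} (h : ∀ x ∈ w, x < t) :
    IsValley (w ++ [t]) ↔ IsValley w := by
  rw [← isValley_reverse, List.reverse_concat, isValley_cons (by simpa using h), isValley_reverse]

theorem IsValley.avoidsPatterns {w : List α} (h : IsValley w) : AvoidsPatterns w := by
  intro a b c d hs
  have habc := h a b c (.trans (by simp) hs)
  have hbcd := h b c d (.trans (by simp) hs)
  exact ⟨fun ⟨_, hbd, hdc⟩ => hbcd ⟨hbd.trans hdc, hdc⟩,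
    fun ⟨_, hdb, hbc⟩ => hbcd ⟨hbc, hdb.trans hbc⟩,
    fun ⟨hca, had, hdb⟩ => habc ⟨had.trans hdb, (hca.trans had).trans hdb⟩⟩

-- In each of the three patterns the last letter is above the first one but is not the greatest.
theorem AvoidsPatterns.append {l m : List α} (hl : AvoidsPatterns l) (hm : AvoidsPatterns m)
    (h : ∀ x ∈ l, ∀ y ∈ m, y < x ∨ ∀ z ∈ l ++ m, z ≤ y) : AvoidsPatterns (l ++ m) := by
  intro a b c d hs
  obtain ⟨l₁, l₂, e, h₁, h₂⟩ := List.sublist_append_iff.1 hs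
  rcases l₁ with _ | ⟨x, l₁⟩
  · exact hm a b c d (e ▸ h₂)
  rcases l₂.eq_nil_or_concat' with rfl | ⟨l₂, y, rfl⟩
  · exact hl a b c d (by simpa [e] using h₁)
  obtain ⟨rfl, hbcd⟩ : a = x ∧ [b, c, d] = l₁ ++ (l₂ ++ [y]) := by simpa using e
  obtain rfl : d = y := by simpa using congrArg List.getLast? hbcd
  rcases h a (h₁.subset (by simp)) d (h₂.subset (by simp)) with hda | hd
  · exact ⟨fun ⟨hab, hbd, _⟩ => lt_asymm hda (hab.trans hbd),
      fun ⟨had, _⟩ => lt_asymm hda had, fun ⟨_, had, _⟩ => lt_asymm hda had⟩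
  · have hbd := (hd b (hs.subset (by simp))).not_gt
    have hcd := (hd c (hs.subset (by simp))).not_gt
    exact ⟨fun ⟨_, _, hdc⟩ => hcd hdc, fun ⟨_, hdb, _⟩ => hbd hdb, fun ⟨_, _, hdb⟩ => hbd hdb⟩

theorem avoidsPatterns_append_cons {n : α} {u w : List α} (hu : u.Pairwise (· > ·))
    (hw : IsValley w) (huw : Unsplit u w) (hn : ∀ x ∈ w, x < n) :
    AvoidsPatterns (u ++ n :: w) := by
  have hnw : IsValley (n :: w) := (isValley_cons hn).2 hw
  intro a b c d h
  obtain ⟨l₁, l₂, e, h₁, h₂⟩ := List.sublist_append_iff.1 h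
  rcases l₁ with _ | ⟨x, _ | ⟨y, l₁⟩⟩
  · exact hnw.avoidsPatterns a b c d (e ▸ h₂)
  · obtain ⟨rfl, rfl⟩ := List.cons.inj e
    have hbcd := hnw b c d h₂
    have hcd := (huw a (h₁.subset (by simp))).forall_sublist h₂.of_cons_cons
    grind
  · obtain ⟨rfl, rfl, -⟩ : a = x ∧ b = y ∧ _ := by simpa using e
    have hba : b < a := hu.forall_sublist (.trans (by simp) h₁)
    grind

end Preorder

section LinearOrder

variable [LinearOrder α]

theorem IsValley.exists_eq_cons_or_eq_concat {t : α} {w : List α} (h : IsValley w) (hn : w.Nodup)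
    (ht : t ∈ w) (hle : ∀ x ∈ w, x ≤ t) : ∃ w', w = t :: w' ∨ w = w' ++ [t] := by
  obtain ⟨s, r, rfl⟩ := List.append_of_mem ht
  rcases s.eq_nil_or_concat' with rfl | ⟨s, x, rfl⟩
  · exact ⟨r, .inl rfl⟩
  rcases r with _ | ⟨y, r⟩
  · exact ⟨_, .inr rfl⟩
  have hxty : [x, t, y] <+ s ++ [x] ++ t :: y :: r := by simp
  have hx : x < t := lt_of_le_of_ne (hle x (by simp)) (by grind)
  have hy : y < t := lt_of_le_of_ne (hle y (by simp)) (by grind)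
  exact absurd ⟨hx, hy⟩ (h x t y hxty)

theorem AvoidsPatterns.unsplit {n : α} {L R : List α} (h : AvoidsPatterns (L ++ n :: R))
    (hn : ∀ x ∈ R, x < n) : Unsplit L R := by
  intro a ha
  refine List.pairwise_of_forall_sublist fun {b c} hbc ⟨hba, hac⟩ => ?_
  have hanbc : [a, n, b, c] <+ L ++ n :: R :=
    (List.singleton_sublist.2 ha).append (hbc.cons_cons n)
  exact (h a n b c hanbc).2.2 ⟨hba, hac, hn c (hbc.subset (by simp))⟩

theorem AvoidsPatterns.pairwise_left {n : α} {L R : List α} (h : AvoidsPatterns (L ++ n :: R))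
    (hLR : (L ++ R).Nodup) (hn : ∀ x ∈ L ++ R, x < n) :
    L.Pairwise fun a b => ∀ r ∈ R, a < r → b < a := by
  refine List.pairwise_of_forall_sublist fun {a b} hab r hr har => ?_
  have habnr : [a, b, n, r] <+ L ++ n :: R :=
    hab.append ((List.singleton_sublist.2 hr).cons_cons n)
  have hne : a ≠ b := by simpa using hLR.of_append_left.sublist hab
  have hbL : b ∈ L := hab.subset (by simp)
  have hbr : b ≠ r := fun e => List.disjoint_of_nodup_append hLR hbL (e ▸ hr)
  have := h a b n r habnr
  have := hn b (List.mem_append_left R hbL)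
  have := hn r (List.mem_append_right L hr)
  grind

theorem AvoidsPatterns.isValley {q : α} {w : List α} (h : AvoidsPatterns (q :: w))
    (hw : w.Nodup) (hq : ∀ x ∈ w, q < x) : IsValley w := by
  intro b c d hbcd ⟨hbc, hdc⟩
  have hbd : b ≠ d := by
    have := hw.sublist hbcd
    grind
  have := h q b c d (hbcd.cons_cons q)
  have := hq b (hbcd.subset (by simp))
  have := hq d (hbcd.subset (by simp))
  grind

end LinearOrder

end OrderedWords

section Intervals

variable {q t n : ℕ} {l m u w : List ℕ}

/-- The word `l` lists every element of the interval `[q, t)` exactly once. -/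
structure ListsIco (q t : ℕ) (l : List ℕ) : Prop where
  nodup : l.Nodup
  mem_iff : ∀ {x}, x ∈ l ↔ q ≤ x ∧ x < t

theorem listsIco_iff_perm : ListsIco q t l ↔ l ~ List.range' q (t - q) := by
  refine ⟨fun h => (List.perm_ext_iff_of_nodup h.nodup List.nodup_range').2 fun x => ?_,
    fun h => ⟨h.nodup_iff.2 List.nodup_range', fun {x} => ?_⟩⟩
  · rw [h.mem_iff, List.mem_range'_1]
    omega
  · rw [h.mem_iff, List.mem_range'_1]
    omega

theorem ListsIco.congr_perm (h : l ~ m) : ListsIco q t l ↔ ListsIco q t m := by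
  rw [listsIco_iff_perm, listsIco_iff_perm, h.congr_left]

theorem listsIco_self : ListsIco q q l ↔ l = [] := by
  rw [listsIco_iff_perm, Nat.sub_self, List.range'_zero, List.perm_nil]

theorem ListsIco.le_of_mem (h : ListsIco q t l) {x : ℕ} (hx : x ∈ l) : q ≤ x :=
  (h.mem_iff.1 hx).1

theorem ListsIco.lt_of_mem (h : ListsIco q t l) {x : ℕ} (hx : x ∈ l) : x < t :=
  (h.mem_iff.1 hx).2

theorem ListsIco.length_eq (h : ListsIco q t l) : l.length = t - q := by
  simpa using (listsIco_iff_perm.1 h).length_eq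

theorem ListsIco.append {r : ℕ} (hl : ListsIco q r l) (hm : ListsIco r t m) (hqr : q ≤ r)
    (hrt : r ≤ t) : ListsIco q t (l ++ m) where
  nodup := hl.nodup.append hm.nodup fun x hxl hxm =>
    (hl.lt_of_mem hxl).not_ge (hm.le_of_mem hxm)
  mem_iff {x} := by
    rw [List.mem_append, hl.mem_iff, hm.mem_iff]
    omega

theorem listsIco_cons_top (h : q ≤ t) : ListsIco q (t + 1) (t :: l) ↔ ListsIco q t l := by
  rw [listsIco_iff_perm, listsIco_iff_perm, Nat.sub_add_comm h, List.range'_concat, one_mul,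
    Nat.add_sub_cancel' h, (List.perm_append_singleton t _).congr_right, List.perm_cons]

theorem listsIco_append_cons_top (h : q ≤ t) :
    ListsIco q (t + 1) (u ++ t :: w) ↔ ListsIco q t (u ++ w) := by
  rw [ListsIco.congr_perm List.perm_middle, listsIco_cons_top h]

theorem listsIco_append_concat_top (h : q ≤ t) :
    ListsIco q (t + 1) (u ++ (w ++ [t])) ↔ ListsIco q t (u ++ w) := by
  rw [ListsIco.congr_perm ((List.perm_append_singleton t w).append_left u),
    listsIco_append_cons_top h]

open Classical in
/-- The pattern avoiding arrangements of the interval `[q, q + n)`. -/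
noncomputable def words (q n : ℕ) : Finset (List ℕ) :=
  {l ∈ (List.range' q n).permutations.toFinset | AvoidsPatterns l}

theorem mem_words : l ∈ words q n ↔ ListsIco q (q + n) l ∧ AvoidsPatterns l := by
  classical
  rw [words, Finset.mem_filter, List.mem_toFinset, List.mem_permutations, listsIco_iff_perm,
    Nat.add_sub_cancel_left]

end Intervals

section Permutations

theorem ofFn_sublist_ofFn_iff {α : Type*} {k n : ℕ} {v : Fin k → α} {w : Fin n → α} :
    List.ofFn v <+ List.ofFn w ↔ ∃ f : Fin k ↪o Fin n, v = w ∘ f := by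
  rw [List.sublist_iff_exists_fin_orderEmbedding_get_eq]
  let castDom := Fin.castOrderIso (List.length_ofFn (f := v))
  let castCod := Fin.castOrderIso (List.length_ofFn (f := w))
  constructor
  · rintro ⟨f, hf⟩
    refine ⟨castDom.symm.toOrderEmbedding.trans (f.trans castCod.toOrderEmbedding), ?_⟩
    exact funext fun i =>
      (List.get_ofFn v _).symm.trans ((hf (castDom.symm i)).trans (List.get_ofFn w _))
  · rintro ⟨f, rfl⟩
    refine ⟨castDom.toOrderEmbedding.trans (f.trans castCod.symm.toOrderEmbedding), fun i => ?_⟩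
    exact (List.get_ofFn (w ∘ f) i).trans (List.get_ofFn w (castCod.symm (f (castDom i)))).symm

variable {n : ℕ}

/-- The one-line notation of `σ`, with all letters shifted up by `q`. -/
def oneLine (q : ℕ) (σ : Equiv.Perm (Fin n)) : List ℕ :=
  List.ofFn fun i => q + (σ i : ℕ)

theorem oneLine_injective (q n : ℕ) :
    Function.Injective (oneLine q : Equiv.Perm (Fin n) → List ℕ) := fun _ _ h =>
  Equiv.ext fun i => Fin.ext (Nat.add_left_cancel (congrFun (List.ofFn_injective h) i))

theorem listsIco_oneLine (q : ℕ) (σ : Equiv.Perm (Fin n)) :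
    ListsIco q (q + n) (oneLine q σ) where
  nodup := List.nodup_ofFn.2 fun _ _ h => σ.injective (Fin.ext (Nat.add_left_cancel h))
  mem_iff {x} := by
    rw [oneLine, List.mem_ofFn]
    refine ⟨?_, fun ⟨hqx, _⟩ => ⟨σ.symm ⟨x - q, by omega⟩, ?_⟩⟩
    · rintro ⟨i, rfl⟩
      exact ⟨Nat.le_add_right _ _, Nat.add_lt_add_left (σ i).2 q⟩
    · rw [Equiv.apply_symm_apply, Nat.add_sub_cancel' hqx]

theorem exists_oneLine_eq {q : ℕ} {l : List ℕ} (h : ListsIco q (q + n) l) :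
    ∃ σ : Equiv.Perm (Fin n), oneLine q σ = l := by
  obtain rfl : l.length = n := by simpa using h.length_eq
  have hmem (i : Fin l.length) : q ≤ l.get i ∧ l.get i < q + l.length :=
    h.mem_iff.1 (l.get_mem i)
  let f (i : Fin l.length) : Fin l.length := ⟨l.get i - q, by have := hmem i; omega⟩
  have hqf (i : Fin l.length) : q + (f i : ℕ) = l.get i := Nat.add_sub_cancel' (hmem i).1
  have hf : Function.Injective f := fun i j hij =>
    List.nodup_iff_injective_get.1 h.nodup (by rw [← hqf, ← hqf, hij])
  refine ⟨Equiv.ofBijective f (Finite.injective_iff_bijective.1 hf), ?_⟩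
  simp only [oneLine, Equiv.ofBijective_apply, hqf, List.ofFn_get]

theorem contains_iff_exists_sublist {k : ℕ} (q : ℕ) {σ : Equiv.Perm (Fin n)}
    {τ : Equiv.Perm (Fin k)} :
    Contains σ τ ↔
      ∃ v : Fin k → ℕ, List.ofFn v <+ oneLine q σ ∧ ∀ i j, v i < v j ↔ τ i < τ j := by
  constructor
  · rintro ⟨f, hf⟩
    exact ⟨_, ofFn_sublist_ofFn_iff.2 ⟨f, rfl⟩, fun i j => by simp [← hf i j]⟩
  · rintro ⟨v, hv, hvτ⟩
    obtain ⟨f, rfl⟩ := ofFn_sublist_ofFn_iff.1 hv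
    exact ⟨f, fun i j => by simp [← hvτ i j]⟩

theorem avoidsPatterns_oneLine (q : ℕ) (σ : Equiv.Perm (Fin n)) :
    AvoidsPatterns (oneLine q σ) ↔ σ ∈ avoiders {p1243, p1342, p2413} n := by
  have h1243 (a b c d : ℕ) : (∀ i j, ![a, b, c, d] i < ![a, b, c, d] j ↔ p1243 i < p1243 j) ↔
      a < b ∧ b < d ∧ d < c := by
    simp [Fin.forall_fin_succ, p1243]
    omega
  have h1342 (a b c d : ℕ) : (∀ i j, ![a, b, c, d] i < ![a, b, c, d] j ↔ p1342 i < p1342 j) ↔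
      a < d ∧ d < b ∧ b < c := by
    simp [Fin.forall_fin_succ, p1342]
    omega
  have h2413 (a b c d : ℕ) : (∀ i j, ![a, b, c, d] i < ![a, b, c, d] j ↔ p2413 i < p2413 j) ↔
      c < a ∧ a < d ∧ d < b := by
    simp [Fin.forall_fin_succ, p2413]
    omega
  have hex (p : (Fin 4 → ℕ) → Prop) : (∃ v, List.ofFn v <+ oneLine q σ ∧ p v) ↔
      ∃ a b c d, [a, b, c, d] <+ oneLine q σ ∧ p ![a, b, c, d] := by
    simp only [Fin.exists_fin_succ_pi, Fin.exists_fin_zero_pi]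
    rfl
  simp only [avoiders, Set.mem_ofPred_eq, Set.mem_insert_iff, Set.mem_singleton_iff,
    forall_eq_or_imp, forall_eq, contains_iff_exists_sublist q, hex, h1243, h1342, h2413]
  simp only [AvoidsPatterns, not_exists, not_and, imp_and, forall_and]

theorem card_words (q n : ℕ) :
    (words q n).card = (avoiders {p1243, p1342, p2413} n).ncard := by
  rw [← Set.ncard_coe_finset, ← Set.ncard_image_of_injective _ (oneLine_injective q n)]
  congr 1
  ext l
  simp only [Finset.mem_coe, mem_words, Set.mem_image]
  constructor
  · rintro ⟨hl, hav⟩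
    obtain ⟨σ, rfl⟩ := exists_oneLine_eq hl
    exact ⟨σ, (avoidsPatterns_oneLine q σ).1 hav, rfl⟩
  · rintro ⟨σ, hσ, rfl⟩
    exact ⟨listsIco_oneLine q σ, (avoidsPatterns_oneLine q σ).2 hσ⟩

end Permutations

section Frames

variable {q t m : ℕ} {u w : List ℕ}

/-- Pairs `(u, w)` that together list `[q, t)`, with `u` decreasing and ending in `q`, such that
`w` is a valley; these are the conditions common to all nonempty cores. -/
structure IsFrame (q t : ℕ) (u w : List ℕ) : Prop where
  lists : ListsIco q t (u ++ w)
  mem : q ∈ u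
  decreasing : u.Pairwise (· > ·)
  valley : IsValley w

theorem IsFrame.lt_of_mem_left (h : IsFrame q t u w) {x : ℕ} (hx : x ∈ u) : x < t :=
  h.lists.lt_of_mem (List.mem_append_left w hx)

theorem IsFrame.lt_of_mem_right (h : IsFrame q t u w) {x : ℕ} (hx : x ∈ w) : x < t :=
  h.lists.lt_of_mem (List.mem_append_right u hx)

theorem IsFrame.disjoint (h : IsFrame q t u w) : u.Disjoint w :=
  List.disjoint_of_nodup_append h.lists.nodup

theorem isFrame_cons_right (hqt : q ≤ t) : IsFrame q (t + 1) u (t :: w) ↔ IsFrame q t u w :=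
  ⟨fun h => ⟨(listsIco_append_cons_top hqt).1 h.lists, h.mem, h.decreasing,
      h.valley.sublist (List.sublist_cons_self t w)⟩,
    fun h => ⟨(listsIco_append_cons_top hqt).2 h.lists, h.mem, h.decreasing,
      (isValley_cons fun _ => h.lt_of_mem_right).2 h.valley⟩⟩

theorem isFrame_concat_right (hqt : q ≤ t) :
    IsFrame q (t + 1) u (w ++ [t]) ↔ IsFrame q t u w :=
  ⟨fun h => ⟨(listsIco_append_concat_top hqt).1 h.lists, h.mem, h.decreasing,
      h.valley.sublist (List.sublist_append_left w [t])⟩,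
    fun h => ⟨(listsIco_append_concat_top hqt).2 h.lists, h.mem, h.decreasing,
      (isValley_concat fun _ => h.lt_of_mem_right).2 h.valley⟩⟩

theorem isFrame_cons_left (hqt : q < t) : IsFrame q (t + 1) (t :: u) w ↔ IsFrame q t u w :=
  ⟨fun h => ⟨(listsIco_cons_top hqt.le).1 h.lists, (List.mem_cons.1 h.mem).resolve_left hqt.ne,
      h.decreasing.of_cons, h.valley⟩,
    fun h => ⟨(listsIco_cons_top hqt.le).2 h.lists, List.mem_cons_of_mem t h.mem,
      List.pairwise_cons.2 ⟨fun _ => h.lt_of_mem_left, h.decreasing⟩, h.valley⟩⟩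

theorem isFrame_nil_right_iff :
    IsFrame q (q + m + 1) u [] ↔ u = (List.range' q (m + 1)).reverse := by
  have hlists : ListsIco q (q + m + 1) (u ++ []) ↔ u ~ List.range' q (m + 1) := by
    rw [List.append_nil, listsIco_iff_perm, add_assoc, Nat.add_sub_cancel_left]
  have hdec : (List.range' q (m + 1)).reverse.Pairwise (· > ·) :=
    List.pairwise_reverse.2 List.pairwise_lt_range'
  constructor
  · intro h
    exact ((hlists.1 h.lists).trans (List.reverse_perm _).symm).eq_of_pairwise
      (fun _ _ _ _ hab hba => absurd hab (Nat.lt_asymm hba)) h.decreasing hdec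
  · rintro rfl
    exact ⟨hlists.2 (List.reverse_perm _), by simp, hdec, isValley_nil⟩

theorem isFrame_singleton_iff : IsFrame q (q + 1) u w ↔ u = [q] ∧ w = [] := by
  constructor
  · intro h
    have hw : w = [] := List.eq_nil_iff_forall_not_mem.2 fun x hx => by
      have hqx := h.lists.le_of_mem (List.mem_append_right u hx)
      have hxq := h.lt_of_mem_right hx
      obtain rfl : x = q := by omega
      exact h.disjoint h.mem hx
    subst hw
    exact ⟨isFrame_nil_right_iff (m := 0).1 h, rfl⟩
  · rintro ⟨rfl, rfl⟩
    exact isFrame_nil_right_iff (m := 0).2 rfl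

theorem IsFrame.top_mem (h : IsFrame q (t + 1) u w) : t ∈ u ∨ t ∈ w :=
  List.mem_append.1 (h.lists.mem_iff.2 ⟨Nat.le_of_lt_succ (h.lt_of_mem_left h.mem), t.lt_succ_self⟩)

theorem IsFrame.exists_eq_cons_left (h : IsFrame q (t + 1) u w) (ht : t ∈ u) :
    ∃ u', u = t :: u' := by
  rcases u with _ | ⟨x, u⟩
  · exact absurd ht List.not_mem_nil
  rcases List.mem_cons.1 ht with rfl | ht
  · exact ⟨u, rfl⟩
  · have htx := List.rel_of_pairwise_cons h.decreasing ht
    have hxt := h.lt_of_mem_left (x := x) (by simp)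
    omega

theorem IsFrame.exists_eq_cons_or_eq_concat_right (h : IsFrame q (t + 1) u w) (ht : t ∈ w) :
    ∃ w', w = t :: w' ∨ w = w' ++ [t] :=
  h.valley.exists_eq_cons_or_eq_concat h.lists.nodup.of_append_right ht
    fun _ hx => Nat.le_of_lt_succ (h.lt_of_mem_right hx)

theorem IsFrame.below_cons_right (h : IsFrame q t u w) : Below u (t :: w) ↔ Below u w :=
  forall₂_congr fun _ ha => by
    rw [List.forall_mem_cons, and_iff_right (h.lt_of_mem_left ha)]

theorem IsFrame.below_concat_right (h : IsFrame q t u w) : Below u (w ++ [t]) ↔ Below u w :=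
  forall₂_congr fun _ ha => by
    rw [List.forall_mem_append, List.forall_mem_singleton, and_iff_left (h.lt_of_mem_left ha)]

theorem IsFrame.ne_nil_and_below_iff (h : IsFrame q (t + 1) u w) :
    w ≠ [] ∧ Below u w ↔ Below u w ∧ t ∈ w := by
  refine ⟨fun ⟨hw, hb⟩ => ⟨hb, h.top_mem.resolve_left fun ht => ?_⟩,
    fun ⟨hb, ht⟩ => ⟨List.ne_nil_of_mem ht, hb⟩⟩
  obtain ⟨b, hbw⟩ := List.exists_mem_of_ne_nil w hw
  exact (hb t ht b hbw).not_ge (Nat.le_of_lt_succ (h.lt_of_mem_right hbw))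

theorem IsFrame.unsplit_cons_right (h : IsFrame q t u w) : Unsplit u (t :: w) ↔ Unsplit u w := by
  refine forall₂_congr fun a ha => ?_
  rw [List.pairwise_cons, and_iff_right]
  exact fun _ _ ⟨hta, _⟩ => lt_asymm hta (h.lt_of_mem_left ha)

theorem IsFrame.unsplit_cons_left (h : IsFrame q t u w) : Unsplit (t :: u) w ↔ Unsplit u w := by
  rw [Unsplit, List.forall_mem_cons, ← Unsplit, and_iff_right]
  exact List.pairwise_of_forall_mem_list fun _ _ _ hc ⟨_, htc⟩ =>
    lt_asymm htc (h.lt_of_mem_right hc)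

theorem IsFrame.unsplit_concat_right (h : IsFrame q t u w) :
    Unsplit u (w ++ [t]) ↔ Below u w := by
  refine forall₂_congr fun a ha => ?_
  have hat : a < t := h.lt_of_mem_left ha
  rw [List.pairwise_append]
  constructor
  · rintro ⟨-, -, hsplit⟩ b hb
    have hba := hsplit b hb t (by simp)
    have hab : a ≠ b := fun e => h.disjoint ha (e ▸ hb)
    omega
  · exact fun hlt => ⟨List.pairwise_of_forall_mem_list fun b hb _ _ ⟨hba, _⟩ =>
        lt_asymm hba (hlt b hb), by simp, fun b hb _ _ ⟨hba, _⟩ => lt_asymm hba (hlt b hb)⟩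

end Frames

section Cores

variable {q t m : ℕ} {u w : List ℕ} {S T : Finset (List ℕ × List ℕ)}

/-- The pairs obtained by putting `t` in front of the first word of a member of `S`. -/
def extendLeft (t : ℕ) (S : Finset (List ℕ × List ℕ)) : Finset (List ℕ × List ℕ) :=
  S.image fun p => (t :: p.1, p.2)

/-- The pairs obtained by putting `t` in front of the second word of a member of `S`, or at the end
of the second word of a member of `T`. -/
def extendRight (t : ℕ) (S T : Finset (List ℕ × List ℕ)) : Finset (List ℕ × List ℕ) :=
  S.image (fun p => (p.1, t :: p.2)) ∪ T.image fun p => (p.1, p.2 ++ [t])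

/-- The frames on `[q, q + m + 1)` with `w` nonempty and above `u`. -/
def lowerFrames (q : ℕ) : ℕ → Finset (List ℕ × List ℕ)
  | 0 => ∅
  | m + 1 => extendRight (q + m + 1)
      (insert ((List.range' q (m + 1)).reverse, []) (lowerFrames q m)) (lowerFrames q m)

/-- The unsplit frames on `[q, q + m + 1)`. -/
def unsplitFrames (q : ℕ) : ℕ → Finset (List ℕ × List ℕ)
  | 0 => {([q], [])}
  | m + 1 => extendLeft (q + m + 1) (unsplitFrames q m) ∪
      extendRight (q + m + 1) (unsplitFrames q m) (lowerFrames q m)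

/-- The pairs `(u, w)` on `[q, q + m)` that are empty, or unsplit frames with top letter in `w`. -/
def cores (q : ℕ) : ℕ → Finset (List ℕ × List ℕ)
  | 0 => {([], [])}
  | 1 => ∅
  | m + 2 => extendRight (q + m + 1) (unsplitFrames q m) (lowerFrames q m)

theorem mem_extendLeft_iff (hqt : q < t)
    (hS : ∀ {u w}, (u, w) ∈ S ↔ IsFrame q t u w ∧ Unsplit u w) :
    (u, w) ∈ extendLeft t S ↔ IsFrame q (t + 1) u w ∧ Unsplit u w ∧ t ∈ u := by
  simp only [extendLeft, Finset.mem_image, Prod.exists, Prod.mk.injEq, hS]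
  constructor
  · rintro ⟨u, w, ⟨hf, hu⟩, rfl, rfl⟩
    exact ⟨(isFrame_cons_left hqt).2 hf, hf.unsplit_cons_left.2 hu, List.mem_cons_self⟩
  · rintro ⟨hf, hu, ht⟩
    obtain ⟨u, rfl⟩ := hf.exists_eq_cons_left ht
    have hf' := (isFrame_cons_left hqt).1 hf
    exact ⟨u, w, ⟨hf', hf'.unsplit_cons_left.1 hu⟩, rfl, rfl⟩

theorem mem_extendRight_iff {P : List ℕ → List ℕ → Prop} (hqt : q ≤ t)
    (hcons : ∀ {u w}, IsFrame q t u w → (P u (t :: w) ↔ P u w))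
    (hconcat : ∀ {u w}, IsFrame q t u w → (P u (w ++ [t]) ↔ Below u w))
    (hS : ∀ {u w}, (u, w) ∈ S ↔ IsFrame q t u w ∧ P u w)
    (hT : ∀ {u w}, (u, w) ∈ T ↔ IsFrame q t u w ∧ w ≠ [] ∧ Below u w) :
    (u, w) ∈ extendRight t S T ↔ IsFrame q (t + 1) u w ∧ P u w ∧ t ∈ w := by
  simp only [extendRight, Finset.mem_union, Finset.mem_image, Prod.exists, Prod.mk.injEq, hS, hT]
  constructor
  · rintro (⟨u, w, ⟨hf, hP⟩, rfl, rfl⟩ | ⟨u, w, ⟨hf, -, hb⟩, rfl, rfl⟩)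
    · exact ⟨(isFrame_cons_right hqt).2 hf, (hcons hf).2 hP, List.mem_cons_self⟩
    · exact ⟨(isFrame_concat_right hqt).2 hf, (hconcat hf).2 hb, by simp⟩
  · rintro ⟨hf, hP, ht⟩
    have of_cons {w : List ℕ} (hf : IsFrame q (t + 1) u (t :: w)) (hP : P u (t :: w)) :
        IsFrame q t u w ∧ P u w :=
      have hf' := (isFrame_cons_right hqt).1 hf
      ⟨hf', (hcons hf').1 hP⟩
    obtain ⟨w, rfl | rfl⟩ := hf.exists_eq_cons_or_eq_concat_right ht
    · exact .inl ⟨u, w, of_cons hf hP, rfl, rfl⟩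
    rcases eq_or_ne w [] with rfl | hw
    · exact .inl ⟨u, [], of_cons hf hP, rfl, rfl⟩
    · have hf' := (isFrame_concat_right hqt).1 hf
      exact .inr ⟨u, w, ⟨hf', hw, (hconcat hf').1 hP⟩, rfl, rfl⟩

theorem mem_insert_lowerFrames
    (hL : (u, w) ∈ lowerFrames q m ↔ IsFrame q (q + m + 1) u w ∧ w ≠ [] ∧ Below u w) :
    (u, w) ∈ insert ((List.range' q (m + 1)).reverse, []) (lowerFrames q m) ↔
      IsFrame q (q + m + 1) u w ∧ Below u w := by
  rw [Finset.mem_insert, Prod.mk.injEq, hL]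
  rcases eq_or_ne w [] with rfl | hw
  · simp [isFrame_nil_right_iff, Below]
  · simp [hw]

theorem mem_lowerFrames : (u, w) ∈ lowerFrames q m ↔
    IsFrame q (q + m + 1) u w ∧ w ≠ [] ∧ Below u w := by
  induction m generalizing u w with
  | zero =>
    simp only [lowerFrames, Finset.notMem_empty, add_zero, isFrame_singleton_iff]
    tauto
  | succ m ih =>
    rw [lowerFrames, mem_extendRight_iff (by omega) IsFrame.below_cons_right
      IsFrame.below_concat_right (mem_insert_lowerFrames ih) ih]
    exact and_congr_right fun hf => hf.ne_nil_and_below_iff.symm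

theorem mem_unsplitFrames : (u, w) ∈ unsplitFrames q m ↔
    IsFrame q (q + m + 1) u w ∧ Unsplit u w := by
  induction m generalizing u w with
  | zero =>
    have hnil : Unsplit u [] := fun _ _ => .nil
    simp only [unsplitFrames, Finset.mem_singleton, Prod.mk.injEq, add_zero, isFrame_singleton_iff]
    exact ⟨fun h => ⟨h, h.2 ▸ hnil⟩, And.left⟩
  | succ m ih =>
    rw [unsplitFrames, Finset.mem_union, mem_extendLeft_iff (by omega) ih,
      mem_extendRight_iff (by omega) IsFrame.unsplit_cons_right IsFrame.unsplit_concat_right ih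
        mem_lowerFrames, ← and_or_left, ← and_or_left]
    exact and_congr_right fun hf => and_iff_left hf.top_mem

theorem mem_cores : (u, w) ∈ cores q m ↔
    (m = 0 ∧ u = [] ∧ w = []) ∨ (IsFrame q (q + m) u w ∧ Unsplit u w ∧ q + m - 1 ∈ w) := by
  rcases m with _ | _ | m
  · have hf : ¬IsFrame q q u w := fun h => (h.lt_of_mem_left h.mem).false
    simp [cores, hf]
  · refine iff_of_false (Finset.notMem_empty _) ?_
    rintro (⟨h, -⟩ | ⟨hf, -, hq⟩)
    · exact Nat.one_ne_zero h
    · exact hf.disjoint hf.mem hq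
  · rw [cores, mem_extendRight_iff (by omega) IsFrame.unsplit_cons_right
      IsFrame.unsplit_concat_right mem_unsplitFrames mem_lowerFrames]
    simp [add_assoc]

theorem card_extendLeft : (extendLeft t S).card = S.card :=
  Finset.card_image_of_injective _ fun _ _ h => by simpa [Prod.ext_iff] using h

theorem card_extendRight (hT : ∀ p ∈ T, p.2 ≠ [] ∧ t ∉ p.2) :
    (extendRight t S T).card = S.card + T.card := by
  rw [extendRight, Finset.card_union_of_disjoint,
    Finset.card_image_of_injective _ fun _ _ h => by simpa [Prod.ext_iff] using h,
    Finset.card_image_of_injective _ fun _ _ h => by simpa [Prod.ext_iff] using h]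
  simp only [Finset.disjoint_left, Finset.mem_image, not_exists, not_and]
  rintro _ ⟨p, -, rfl⟩ ⟨u, w⟩ hp h
  obtain ⟨hw, ht⟩ := hT _ hp
  obtain ⟨x, w, rfl⟩ := List.exists_cons_of_ne_nil hw
  simp_all

theorem ne_nil_and_notMem_of_mem_lowerFrames (p : List ℕ × List ℕ) (hp : p ∈ lowerFrames q m) :
    p.2 ≠ [] ∧ q + m + 1 ∉ p.2 :=
  have ⟨hf, hw, _⟩ := mem_lowerFrames.1 hp
  ⟨hw, fun h => (hf.lt_of_mem_right h).false⟩

theorem card_lowerFrames (q m : ℕ) : (lowerFrames q m).card + 1 = 2 ^ m := by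
  induction m with
  | zero => rfl
  | succ m ih =>
    rw [lowerFrames, card_extendRight ne_nil_and_notMem_of_mem_lowerFrames,
      Finset.card_insert_of_notMem fun h => (ne_nil_and_notMem_of_mem_lowerFrames _ h).1 rfl]
    omega

theorem disjoint_extendLeft_extendRight (hS : ∀ p ∈ S, t ∉ p.1) (hT : ∀ p ∈ T, t ∉ p.1)
    (S' : Finset (List ℕ × List ℕ)) : Disjoint (extendLeft t S') (extendRight t S T) := by
  simp only [extendLeft, extendRight, Finset.disjoint_left, Finset.mem_union, Finset.mem_image,
    not_or, not_exists, not_and]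
  rintro _ ⟨p, -, rfl⟩
  exact ⟨fun r hr h => hS r hr (by simp [(Prod.mk.inj h).1]),
    fun r hr h => hT r hr (by simp [(Prod.mk.inj h).1])⟩

theorem two_mul_card_unsplitFrames (q m : ℕ) :
    2 * (unsplitFrames q m).card = m * 2 ^ m + 2 := by
  induction m with
  | zero => rfl
  | succ m ih =>
    have hdisj := disjoint_extendLeft_extendRight
      (fun p (hp : p ∈ unsplitFrames q m) h =>
        ((mem_unsplitFrames.1 hp).1.lt_of_mem_left h).false)
      (fun p (hp : p ∈ lowerFrames q m) h => ((mem_lowerFrames.1 hp).1.lt_of_mem_left h).false)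
      (unsplitFrames q m)
    have hlower := card_lowerFrames q m
    rw [unsplitFrames, Finset.card_union_of_disjoint hdisj, card_extendLeft,
      card_extendRight ne_nil_and_notMem_of_mem_lowerFrames, pow_succ]
    linarith

theorem two_mul_card_cores_add_two (q m : ℕ) :
    2 * (cores q (m + 2)).card = (m + 2) * 2 ^ m := by
  have hunsplit := two_mul_card_unsplitFrames q m
  have hlower := card_lowerFrames q m
  rw [cores, card_extendRight ne_nil_and_notMem_of_mem_lowerFrames]
  linarith

theorem card_cores_eq (q m : ℕ) : (cores q m).card = (cores 0 m).card := by
  rcases m with _ | _ | m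
  · rfl
  · rfl
  · linarith [two_mul_card_cores_add_two q m, two_mul_card_cores_add_two 0 m]

/-- The generating function of the cores. -/
noncomputable def coreSeries : ℚ⟦X⟧ := PowerSeries.mk fun m => ((cores 0 m).card : ℚ)

theorem one_sub_two_X_sq_mul_coreSeries :
    (1 - 2 * X) ^ 2 * coreSeries = 1 - 4 * X + 5 * X ^ 2 - X ^ 3 := by
  set S : ℚ⟦X⟧ := PowerSeries.mk fun m => (m + 2) * 2 ^ m / 2 with hS
  have hcore : coreSeries = 1 + X * (X * S) := by
    ext n
    rcases n with _ | _ | n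
    · simp [coreSeries, cores]
    · simp [coreSeries, cores, coeff_one]
    · have hcard := two_mul_card_cores_add_two 0 n
      have hcard' : 2 * ((cores 0 (n + 2)).card : ℚ) = (n + 2) * 2 ^ n := by exact_mod_cast hcard
      rw [map_add, coeff_one, if_neg (Nat.succ_ne_zero _), coeff_succ_X_mul, coeff_succ_X_mul,
        coreSeries, hS, coeff_mk, coeff_mk]
      linarith
  have hmul : (1 - 2 * X) ^ 2 * S = 1 - X := by
    have hexp : (1 - 2 * X) ^ 2 * S = S - C 4 * (X * S) + C 4 * (X * (X * S)) := by
      rw [map_ofNat]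
      ring
    rw [hexp]
    ext n
    rcases n with _ | _ | n
    · simp [hS]
    · norm_num [coeff_succ_X_mul, coeff_one, coeff_X, hS]
    · rw [map_add, map_sub, map_sub, coeff_C_mul, coeff_C_mul, coeff_succ_X_mul, coeff_succ_X_mul,
        coeff_succ_X_mul, coeff_one, if_neg (Nat.succ_ne_zero _), coeff_X, if_neg (by omega), hS,
        coeff_mk, coeff_mk, coeff_mk]
      push_cast
      ring
  rw [hcore]
  linear_combination X ^ 2 * hmul

end Cores

section Cuts

variable {q t n : ℕ} {L R : List ℕ}

/-- `t` is the least strict upper bound of the letters of `R`, and `q` is the least letter of `L`,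
or `t` if no letter of `L` is smaller than `t`. -/
structure IsCut (L R : List ℕ) (q t : ℕ) : Prop where
  le : q ≤ t
  le_left : ∀ x ∈ L, q ≤ x
  lt_right : ∀ x ∈ R, x < t
  mem_left : q < t → q ∈ L
  pred_mem_right : 0 < t → t - 1 ∈ R

theorem exists_isCut (L R : List ℕ) : ∃ q t, IsCut L R q t := by
  obtain ⟨t, ht, ht'⟩ : ∃ t, (∀ x ∈ R, x < t) ∧ (0 < t → t - 1 ∈ R) := by
    rcases R.toFinset.eq_empty_or_nonempty with hR | hR
    · obtain rfl : R = [] := by simpa using hR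
      exact ⟨0, by simp⟩
    · have hmem : R.toFinset.max' hR ∈ R := List.mem_toFinset.1 (Finset.max'_mem _ hR)
      exact ⟨R.toFinset.max' hR + 1,
        fun x hx => Nat.lt_succ_of_le (Finset.le_max' _ x (List.mem_toFinset.2 hx)),
        fun _ => hmem⟩
  have hne : (insert t L.toFinset).Nonempty := Finset.insert_nonempty t _
  have hle : ∀ x ∈ insert t L.toFinset, (insert t L.toFinset).min' hne ≤ x := fun x hx =>
    Finset.min'_le _ x hx
  refine ⟨(insert t L.toFinset).min' hne, t, hle t (by simp), fun x hx => hle x (by simp [hx]), ht,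
    fun hlt => ?_, ht'⟩
  simpa [hlt.ne] using Finset.min'_mem _ hne

theorem IsCut.unique {q' t' : ℕ} (h : IsCut L R q t) (h' : IsCut L R q' t') :
    q = q' ∧ t = t' := by
  have upper_le {q t q' t' : ℕ} (h : IsCut L R q t) (h' : IsCut L R q' t') : t ≤ t' := by
    rcases t.eq_zero_or_pos with rfl | ht
    · exact Nat.zero_le t'
    · have := h'.lt_right _ (h.pred_mem_right ht)
      omega
  obtain rfl : t = t' := (upper_le h h').antisymm (upper_le h' h)
  have lower_le {q q' : ℕ} (h : IsCut L R q t) (h' : IsCut L R q' t) : q ≤ q' :=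
    h'.le.eq_or_lt.elim (fun e => e ▸ h.le) fun hlt => h.le_left q' (h'.mem_left hlt)
  exact ⟨(lower_le h h').antisymm (lower_le h' h), rfl⟩

theorem IsCut.le_top (hc : IsCut L R q t) (h : ListsIco 0 n (L ++ R)) : t ≤ n := by
  rcases t.eq_zero_or_pos with rfl | ht
  · exact Nat.zero_le n
  · have := h.lt_of_mem (List.mem_append_right L (hc.pred_mem_right ht))
    omega

theorem IsCut.listsIco_upper (hc : IsCut L R q t) (h : ListsIco 0 n (L ++ R)) :
    ListsIco t n (L.filter (t ≤ ·)) where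
  nodup := h.nodup.of_append_left.filter _
  mem_iff {x} := by
    have hx := h.mem_iff (x := x)
    have hR := hc.lt_right x
    simp only [List.mem_append, List.mem_filter, decide_eq_true_eq] at hx ⊢
    grind

theorem IsCut.listsIco_middle (hc : IsCut L R q t) (h : ListsIco 0 n (L ++ R)) :
    ListsIco q t ((L.filter fun x => ¬t ≤ x) ++ R.filter (q ≤ ·)) where
  nodup := h.nodup.sublist (List.filter_sublist.append List.filter_sublist)
  mem_iff {x} := by
    have hx := h.mem_iff (x := x)
    have hL := hc.le_left x
    have hR := hc.lt_right x
    have ht := hc.le_top h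
    simp only [List.mem_append, List.mem_filter, decide_eq_true_eq] at hx ⊢
    grind

theorem IsCut.listsIco_lower (hc : IsCut L R q t) (h : ListsIco 0 n (L ++ R)) :
    ListsIco 0 q (R.filter fun x => ¬q ≤ x) where
  nodup := h.nodup.of_append_right.filter _
  mem_iff {x} := by
    have hx := h.mem_iff (x := x)
    have hL := hc.le_left x
    have hq := hc.le.trans (hc.le_top h)
    simp only [List.mem_append, List.mem_filter, decide_eq_true_eq] at hx ⊢
    grind

theorem IsCut.pairwise_left (hc : IsCut L R q t) (h : ListsIco 0 n (L ++ R))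
    (hav : AvoidsPatterns (L ++ n :: R)) : L.Pairwise fun a b => a < t → b < a := by
  refine (hav.pairwise_left h.nodup fun _ => h.lt_of_mem).imp_of_mem fun {a b} ha _ hab hat => ?_
  have hr : t - 1 ∈ R := hc.pred_mem_right (Nat.zero_lt_of_lt hat)
  have hne : a ≠ t - 1 := fun e => List.disjoint_of_nodup_append h.nodup ha (e ▸ hr)
  exact hab _ hr (by omega)

theorem IsCut.left_eq (hc : IsCut L R q t) (h : ListsIco 0 n (L ++ R))
    (hav : AvoidsPatterns (L ++ n :: R)) :
    L = L.filter (t ≤ ·) ++ L.filter fun x => ¬t ≤ x :=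
  eq_filter_append_filter_not <| (hc.pairwise_left h hav).imp fun hab htb => by omega

theorem IsCut.right_eq (hc : IsCut L R q t) (h : ListsIco 0 n (L ++ R))
    (hav : AvoidsPatterns (L ++ n :: R)) :
    R = R.filter (q ≤ ·) ++ R.filter fun x => ¬q ≤ x := by
  refine eq_filter_append_filter_not ?_
  rcases hc.le.eq_or_lt with rfl | hlt
  · exact List.pairwise_of_forall_mem_list fun _ _ c hcR hqc =>
      absurd (hc.lt_right c hcR) hqc.not_gt
  · have hq : q ∈ L := hc.mem_left hlt
    have hunsplit : Unsplit L R :=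
      hav.unsplit fun _ hx => h.lt_of_mem (List.mem_append_right L hx)
    refine (hunsplit q hq).imp_of_mem fun {b c} _ hcR hbc hqc => ?_
    have hne : q ≠ c := fun e => List.disjoint_of_nodup_append h.nodup hq (e ▸ hcR)
    omega

theorem IsCut.isFrame (hc : IsCut L R q t) (hqt : q < t) (h : ListsIco 0 n (L ++ R))
    (hav : AvoidsPatterns (L ++ n :: R)) :
    IsFrame q t (L.filter fun x => ¬t ≤ x) (R.filter (q ≤ ·)) where
  lists := hc.listsIco_middle h
  mem := by simpa [hqt] using hc.mem_left hqt
  decreasing := List.pairwise_filter.2 <| (hc.pairwise_left h hav).imp fun hab hta _ =>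
    hab (by simpa using hta)
  valley := by
    have hq : q ∈ L := hc.mem_left hqt
    have hsub : q :: R.filter (q ≤ ·) <+ L ++ n :: R :=
      (List.singleton_sublist.2 hq).append (List.filter_sublist.cons n)
    refine (hav.sublist hsub).isValley (h.nodup.of_append_right.filter _) fun x hx => ?_
    obtain ⟨hxR, hqx⟩ := List.mem_filter.1 hx
    exact (of_decide_eq_true hqx).lt_of_ne fun e =>
      List.disjoint_of_nodup_append h.nodup hq (e ▸ hxR)

theorem IsCut.mem_cores {m : ℕ} (hc : IsCut L R q (q + m)) (h : ListsIco 0 n (L ++ R))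
    (hav : AvoidsPatterns (L ++ n :: R)) :
    (L.filter fun x => ¬q + m ≤ x, R.filter (q ≤ ·)) ∈ cores q m := by
  rw [PatternAvoidance.mem_cores]
  rcases m.eq_zero_or_pos with rfl | hm
  · have hnil := listsIco_self.1 (hc.listsIco_middle h)
    exact .inl ⟨rfl, List.append_eq_nil_iff.1 hnil⟩
  · have hqt : q < q + m := Nat.lt_add_of_pos_right hm
    have htop : q + m - 1 ∈ R := hc.pred_mem_right (Nat.zero_lt_of_lt hqt)
    have hunsplit : Unsplit L R :=
      hav.unsplit fun _ hx => h.lt_of_mem (List.mem_append_right L hx)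
    exact .inr ⟨hc.isFrame hqt h hav,
      hunsplit.sublist List.filter_sublist List.filter_sublist,
      List.mem_filter.2 ⟨htop, decide_eq_true (Nat.le_sub_one_of_lt hqt)⟩⟩

end Cuts

section Factorizations

variable {n q m p : ℕ} {A u w D : List ℕ}

theorem listsIco_of_mem_cores (h : (u, w) ∈ cores q m) : ListsIco q (q + m) (u ++ w) := by
  obtain ⟨rfl, rfl, rfl⟩ | ⟨hf, -⟩ := mem_cores.1 h
  · exact listsIco_self.2 rfl
  · exact hf.lists

theorem avoidsPatterns_of_mem_cores (h : (u, w) ∈ cores q m) (hn : ∀ x ∈ w, x < n) :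
    AvoidsPatterns (u ++ n :: w) := by
  obtain ⟨rfl, rfl, rfl⟩ | ⟨hf, hunsplit, -⟩ := mem_cores.1 h
  · exact avoidsPatterns_append_cons .nil isValley_nil (fun _ _ => .nil) hn
  · exact avoidsPatterns_append_cons hf.decreasing hf.valley hunsplit hn

/-- The factors of the word `A u n w D` on `[0, n + 1)`, where `n = q + m + p`: avoiding words `A`
on `[q + m, n)` and `D` on `[0, q)`, and a core `(u, w)` on `[q, q + m)`. -/
structure IsFactorization (q m p : ℕ) (A u w D : List ℕ) : Prop where
  upper : A ∈ words (q + m) p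
  core : (u, w) ∈ cores q m
  lower : D ∈ words 0 q

/-- The word with the given upper, core and lower factors and the greatest letter `n`. -/
def assemble (n : ℕ) (A : List ℕ) (c : List ℕ × List ℕ) (D : List ℕ) : List ℕ :=
  A ++ c.1 ++ n :: (c.2 ++ D)

namespace IsFactorization

theorem listsIco_upper (h : IsFactorization q m p A u w D) : ListsIco (q + m) (q + m + p) A :=
  (mem_words.1 h.upper).1

theorem listsIco_lower (h : IsFactorization q m p A u w D) : ListsIco 0 q D :=
  Nat.zero_add q ▸ (mem_words.1 h.lower).1

theorem listsIco (h : IsFactorization q m p A u w D) :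
    ListsIco 0 (q + m + p) (A ++ u ++ (w ++ D)) := by
  have hperm : A ++ u ++ (w ++ D) ~ D ++ (u ++ w) ++ A := by
    rw [← Multiset.coe_eq_coe]
    simp only [← Multiset.coe_add]
    abel
  rw [ListsIco.congr_perm hperm]
  exact (h.listsIco_lower.append (listsIco_of_mem_cores h.core) (by omega) (by omega)).append
    h.listsIco_upper (by omega) (by omega)

theorem avoidsPatterns (h : IsFactorization q m p A u w D) :
    AvoidsPatterns (A ++ u ++ (q + m + p) :: (w ++ D)) := by
  have hcore := listsIco_of_mem_cores h.core
  have hmid : AvoidsPatterns (u ++ (q + m + p) :: w) :=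
    avoidsPatterns_of_mem_cores h.core fun x hx =>
      (hcore.lt_of_mem (List.mem_append_right u hx)).trans_le (Nat.le_add_right _ p)
  have hA := fun x => h.listsIco_upper.mem_iff (x := x)
  have hD := fun x => h.listsIco_lower.mem_iff (x := x)
  have huw := fun x => hcore.mem_iff (x := x)
  have hlow : AvoidsPatterns (u ++ (q + m + p) :: w ++ D) :=
    hmid.append (mem_words.1 h.lower).2 fun x hx y hy => .inl <| by
      simp only [List.mem_append, List.mem_cons] at hx huw
      grind
  have hword : AvoidsPatterns (A ++ (u ++ (q + m + p) :: w ++ D)) :=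
    (mem_words.1 h.upper).2.append hlow fun x hx y hy => by
      simp only [List.mem_append, List.mem_cons] at hy huw ⊢
      grind
  simpa using hword

theorem isCut (h : IsFactorization q m p A u w D) : IsCut (A ++ u) (w ++ D) q (q + m) where
  le := Nat.le_add_right q m
  le_left x hx := by
    rcases List.mem_append.1 hx with hx | hx
    · exact (Nat.le_add_right q m).trans (h.listsIco_upper.le_of_mem hx)
    · exact (listsIco_of_mem_cores h.core).le_of_mem (List.mem_append_left w hx)
  lt_right x hx := by
    rcases List.mem_append.1 hx with hx | hx
    · exact (listsIco_of_mem_cores h.core).lt_of_mem (List.mem_append_right u hx)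
    · exact (h.listsIco_lower.lt_of_mem hx).trans_le (Nat.le_add_right q m)
  mem_left hm := by
    obtain ⟨rfl, -⟩ | ⟨hf, -⟩ := mem_cores.1 h.core
    · exact absurd hm q.lt_irrefl
    · exact List.mem_append_right A hf.mem
  pred_mem_right ht := by
    obtain ⟨rfl, -⟩ | ⟨-, -, htop⟩ := mem_cores.1 h.core
    · exact List.mem_append_right w (h.listsIco_lower.mem_iff.2 ⟨Nat.zero_le _, by omega⟩)
    · exact List.mem_append_left D htop

theorem assemble_mem_words (h : IsFactorization q m p A u w D) (hn : q + m + p = n) :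
    assemble n A (u, w) D ∈ words 0 (n + 1) := by
  subst hn
  rw [mem_words, Nat.zero_add]
  exact ⟨(listsIco_append_cons_top (Nat.zero_le _)).2 h.listsIco, h.avoidsPatterns⟩

theorem eq_of_assemble_eq {q' m' p' : ℕ} {A' u' w' D' : List ℕ}
    (h : IsFactorization q m p A u w D) (h' : IsFactorization q' m' p' A' u' w' D')
    (hn : q + m + p = n) (hn' : q' + m' + p' = n)
    (e : assemble n A (u, w) D = assemble n A' (u', w') D') :
    (q = q' ∧ m = m' ∧ p = p') ∧ A = A' ∧ u = u' ∧ w = w' ∧ D = D' := by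
  have hmem : n ∉ A ++ u ++ (w ++ D) := fun hmem => by
    have := h.listsIco.lt_of_mem hmem
    omega
  obtain ⟨hleft, -, hright⟩ := (List.append_cons_inj_of_notMem
    (mt (List.mem_append_left _) hmem) (mt (List.mem_append_right _) hmem)).1 e
  have hcut : IsCut (A ++ u) (w ++ D) q' (q' + m') := hleft ▸ hright ▸ h'.isCut
  obtain ⟨rfl, hm⟩ := h.isCut.unique hcut
  obtain rfl : m = m' := Nat.add_left_cancel hm
  obtain rfl : p = p' := by omega
  obtain ⟨rfl, rfl⟩ := List.append_inj hleft
    (by rw [h.listsIco_upper.length_eq, h'.listsIco_upper.length_eq])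
  obtain ⟨rfl, rfl⟩ := List.append_inj' hright
    (by rw [h.listsIco_lower.length_eq, h'.listsIco_lower.length_eq])
  exact ⟨⟨rfl, rfl, rfl⟩, rfl, rfl, rfl, rfl⟩

end IsFactorization

theorem exists_isFactorization {l : List ℕ} (hl : l ∈ words 0 (n + 1)) :
    ∃ q m p A u w D, q + m + p = n ∧ IsFactorization q m p A u w D ∧
      assemble n A (u, w) D = l := by
  rw [mem_words, Nat.zero_add] at hl
  obtain ⟨hlists, hav⟩ := hl
  obtain ⟨L, R, rfl⟩ := List.append_of_mem (hlists.mem_iff.2 ⟨Nat.zero_le n, n.lt_succ_self⟩)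
  replace hlists := (listsIco_append_cons_top (Nat.zero_le n)).1 hlists
  obtain ⟨q, t, hc⟩ := exists_isCut L R
  obtain ⟨m, rfl⟩ := Nat.exists_eq_add_of_le hc.le
  obtain ⟨p, rfl⟩ := Nat.exists_eq_add_of_le (hc.le_top hlists)
  have hleft : AvoidsPatterns L := hav.sublist (List.sublist_append_left L _)
  have hright : AvoidsPatterns R := hav.sublist ((List.sublist_cons_self _ R).trans
    (List.sublist_append_right L _))
  refine ⟨q, m, p, _, _, _, R.filter fun x => ¬q ≤ x, rfl,
    ⟨mem_words.2 ⟨hc.listsIco_upper hlists, hleft.sublist List.filter_sublist⟩,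
      hc.mem_cores hlists hav, mem_words.2 ⟨?_, hright.sublist List.filter_sublist⟩⟩, ?_⟩
  · rw [Nat.zero_add]
    exact hc.listsIco_lower hlists
  · rw [assemble, ← hc.left_eq hlists hav, ← hc.right_eq hlists hav]

end Factorizations

section Counting

open Finset.HasAntidiagonal

/-- The factors of the words on `[0, n + 1)`, indexed by the sizes of their alphabets. -/
noncomputable def factorizations (n : ℕ) :
    Finset (Σ _ : ℕ × ℕ, (Σ _ : ℕ × ℕ, List ℕ × (List ℕ × List ℕ)) × List ℕ) :=
  (antidiagonal n).sigma fun x =>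
    ((antidiagonal x.1).sigma fun y => words 0 y.1 ×ˢ cores y.1 y.2) ×ˢ words x.1 x.2

theorem mem_factorizations {n k p q m : ℕ} {A u w D : List ℕ} :
    ⟨(k, p), ⟨(q, m), D, u, w⟩, A⟩ ∈ factorizations n ↔
      (k + p = n ∧ q + m = k) ∧ IsFactorization q m p A u w D := by
  simp only [factorizations, Finset.mem_sigma, Finset.mem_product, mem_antidiagonal]
  constructor
  · rintro ⟨hn, ⟨rfl, hD, hcore⟩, hA⟩
    exact ⟨⟨hn, rfl⟩, hA, hcore, hD⟩
  · rintro ⟨⟨hn, rfl⟩, hA, hcore, hD⟩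
    exact ⟨hn, ⟨rfl, hD, hcore⟩, hA⟩

theorem card_words_succ (n : ℕ) : (words 0 (n + 1)).card = (factorizations n).card := by
  symm
  refine Finset.card_nbij (fun f => assemble n f.2.2 f.2.1.2.2 f.2.1.2.1) ?_ ?_ ?_
  · rintro ⟨⟨_, p⟩, ⟨⟨q, m⟩, D, u, w⟩, A⟩ hmem
    obtain ⟨⟨hn, rfl⟩, hf⟩ := mem_factorizations.1 hmem
    exact hf.assemble_mem_words hn
  · rintro ⟨⟨_, p⟩, ⟨⟨q, m⟩, D, u, w⟩, A⟩ hmem ⟨⟨_, p'⟩, ⟨⟨q', m'⟩, D', u', w'⟩, A'⟩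
      hmem' e
    obtain ⟨⟨hn, rfl⟩, hf⟩ := mem_factorizations.1 hmem
    obtain ⟨⟨hn', rfl⟩, hf'⟩ := mem_factorizations.1 hmem'
    obtain ⟨⟨rfl, rfl, rfl⟩, rfl, rfl, rfl, rfl⟩ := hf.eq_of_assemble_eq hf' hn hn' e
    rfl
  · intro l hl
    obtain ⟨q, m, p, A, u, w, D, hn, hf, hl⟩ := exists_isFactorization hl
    exact ⟨⟨(q + m, p), ⟨(q, m), D, u, w⟩, A⟩, mem_factorizations.2 ⟨⟨hn, rfl⟩, hf⟩, hl⟩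

theorem card_factorizations (n : ℕ) :
    (factorizations n).card = ∑ x ∈ antidiagonal n,
      (∑ y ∈ antidiagonal x.1, (words 0 y.1).card * (cores 0 y.2).card) * (words 0 x.2).card := by
  simp only [factorizations, Finset.card_sigma, Finset.card_product, card_cores_eq,
    card_words]

theorem genFun_eq_one_add : genFun {p1243, p1342, p2413} =
    1 + X * (genFun {p1243, p1342, p2413} * coreSeries * genFun {p1243, p1342, p2413}) := by
  have hgenFun : genFun {p1243, p1342, p2413} = PowerSeries.mk fun n => ((words 0 n).card : ℚ) := by
    simp only [genFun, card_words]
  rw [hgenFun]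
  ext n
  rcases n with _ | n
  · have hwords : words 0 0 = {[]} := by
      ext l
      rw [mem_words, listsIco_self, Finset.mem_singleton, and_iff_left_iff_imp]
      rintro rfl
      exact isValley_nil.avoidsPatterns
    simp [hwords]
  · rw [map_add, coeff_succ_X_mul, coeff_mk, card_words_succ, card_factorizations]
    simp [coeff_mul, coeff_one, coreSeries]

end Counting

section Quadratic

theorem one_sub_sq_eq_of_eq_one_add {A : Type*} [CommRing A] {F H x : A}
    (h : F = 1 + x * (F * H * F)) : (1 - 2 * (x * F * H)) ^ 2 = 1 - 4 * (x * H) := by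
  linear_combination (-4 * x * H) * h

theorem denominator_ne_zero : (2 * X * (1 - 4 * X + 5 * X ^ 2 - X ^ 3) : ℚ⟦X⟧) ≠ 0 := by
  have hconst : constantCoeff (2 * (1 - 4 * X + 5 * X ^ 2 - X ^ 3) : ℚ⟦X⟧) ≠ 0 := by
    simp [map_ofNat]
  rw [mul_comm 2, mul_assoc]
  exact mul_ne_zero X_ne_zero fun h => hconst (by rw [h, map_zero])

end Quadratic

end PatternAvoidance

/-- `R` is the formal square root of `1 - 8x + 20x² - 20x³ + 4x⁴` with constant term `1` (there is
only one, as the other root is `-R`); the quotient is taken in the field of formal Laurent series,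
where its denominator is nonzero. -/
theorem mainTheorem10 :
    ∃ R : ℚ⟦X⟧,
      PowerSeries.constantCoeff R = 1 ∧
      R ^ 2 = 1 - 8 * (X : ℚ⟦X⟧) + 20 * X ^ 2 - 20 * X ^ 3 + 4 * X ^ 4 ∧
      ((PatternAvoidance.genFun {PatternAvoidance.p1243, PatternAvoidance.p1342,
          PatternAvoidance.p2413} : ℚ⟦X⟧) : ℚ⸨X⸩) =
        (((1 - 2 * X) * (1 - 2 * X - R) : ℚ⟦X⟧) : ℚ⸨X⸩) /
          ((2 * X * (1 - 4 * X + 5 * X ^ 2 - X ^ 3) : ℚ⟦X⟧) : ℚ⸨X⸩) := by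
  set F := PatternAvoidance.genFun {PatternAvoidance.p1243, PatternAvoidance.p1342,
    PatternAvoidance.p2413}
  set H := PatternAvoidance.coreSeries
  have hcore : (1 - 2 * X) ^ 2 * H = 1 - 4 * X + 5 * X ^ 2 - X ^ 3 :=
    PatternAvoidance.one_sub_two_X_sq_mul_coreSeries
  have hsq : (1 - 2 * (X * F * H)) ^ 2 = 1 - 4 * (X * H) :=
    PatternAvoidance.one_sub_sq_eq_of_eq_one_add PatternAvoidance.genFun_eq_one_add
  refine ⟨(1 - 2 * X) * (1 - 2 * (X * F * H)), by simp, ?_, ?_⟩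
  · linear_combination (1 - 2 * X) ^ 2 * hsq - 4 * X * hcore
  · rw [eq_div_iff ((map_ne_zero_iff _ HahnSeries.ofPowerSeries_injective).2
      PatternAvoidance.denominator_ne_zero), ← map_mul (HahnSeries.ofPowerSeries ℤ ℚ)]
    congr 1
    linear_combination (-2 * X * F) * hcore
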